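/- Let $M$ be a semisimple Frobenius manifold of dimension $n\ge 1$ with flat coordinates $v^1,\dots,v^n$, flat metric $\eta_{\alpha\beta}$, potential $F$, unit $e=\partial/\partial v^1$ and Euler vector field $E=\sum_i u_i\,\partial/\partial u_i$. Here $u_1,\dots,u_n$ are canonical coordinates, $\partial/\partial u_i\cdot\partial/\partial u_j=\delta_{ij}\,\partial/\partial u_i$, $h_i$ is a holomorphic choice of square roots of $\langle\partial/\partial u_i,\partial/\partial u_i\rangle$, and $\gamma_{ij}=h_i^{-1}\partial h_j/\partial u_i$ $(i\neq j)$. Let $G$ be a $G$-function of $M$, i.e. a holomorphic function with $$\frac{\partial G}{\partial u_i}=\frac12\sum_{j\ne i}(u_i-u_j)\gamma_{ij}^2-\frac1{24}\sum_{k\ne i}\gamma_{ik}\Big(\frac{h_i}{h_k}-\frac{h_k}{h_i}\Big).$$ Fix a calibration $\theta_{\alpha}(v;z)=\sum_{p\ge0}\theta_{\alpha,p}(v)z^p$ of $M$, with two-point functions $\Omega_{\alpha,p;\beta,q}$ defined by $\sum_{p,q}\Omega_{\alpha,p;\beta,q}z^pw^q=\frac{\langle\nabla\theta_\alpha(z),\nabla\theta_\beta(w)\rangle-\eta_{\alpha\beta}}{z+w}$.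 Let $\mathbf t=(t^{\alpha,p})_{1\le\alpha\le n,\,p\ge0}$ be the coordinates on the big phase space, $x=t^{1,0}$, $\tilde t^{\alpha,p}=t^{\alpha,p}-\delta^\alpha_1\delta^p_1$, and let $v(\mathbf t)$ be the topological solution, i.e. a holomorphic solution of $\sum\tilde t^{\alpha,p}\nabla\theta_{\alpha,p}(v)=0$. Put $$\mathcal F_0=\frac12\sum\Omega_{\alpha,p;\beta,q}(v(\mathbf t))\,\tilde t^{\alpha,p}\tilde t^{\beta,q},\qquad \mathcal F_1=\frac1{24}\sum_i\log u_{i,x}+G(v(\mathbf t)),\qquad M_{\alpha\beta}=\frac{\partial^3\mathcal F_0}{\partial t^{1,0}\partial t^{\alpha,0}\partial t^{\beta,0}} .$$ To a graph whose vertices have genus $0$ or $1$ associate the function of $\mathbf t$ obtained by the following rules: a vertex of genus $g$ is $\mathcal F_g$, a leg is $\partial/\partial t^{1,0}$, an edge is $(M^{-1})^{\alpha\alpha'}\,\partial/\partial t^{\alpha,0}\otimes\partial/\partial t^{\alpha',0}$; all derivatives act on the vertices first, and the contractions with $M^{-1}$ are carried out at the end. Let $Q_1,\dots,Q_{16}$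 be the functions of the following graphs, where the vertices are $A,B,C,D$ (of genus $0$ unless marked by a superscript $1$, e.g. $B^1$), the word before the colon lists the edges ($AA$ is a loop) and the numbers after it are the numbers of legs at $A,B,\dots$ in order. $Q_1$: $AA,AA:2$; $Q_2$: $AB,AB,AB:1,2$; $Q_3$: $AA,AB,AB:1,2$; $Q_4$: $AB,AB,AC,BC:1,1,2$; $Q_5$: $AA,AB,AB:0,3$; $Q_6$: $AB,AB,AB:0,3$; $Q_7$: $AB,AB,AC,AC:0,2,2$; $Q_8$: $AB,AB,AC,BC:1,0,3$; $Q_9$: $AA,AB,BC,CA:0,2,2$; $Q_{10}$: $AB,AB,AC,BC:2,0,2$; $Q_{11}$: $AB,AB,AC,CD,DB:1,0,2,2$; $Q_{12}$: $AB,AC,CB,AD,DB:1,0,2,2$; $Q_{13}$: $AB^1,AB^1:2,0$; $Q_{14}$: $A^1A^1:1$; $Q_{15}$: $AA,AB^1:1,1$; $Q_{16}$: $A^1B^1:1,0$. Then $\partial_eG=0$ on $M$, and at every point of the small phase space $t^{\gamma,p}=0$ $(p>0)$ in the domain of $v(\mathbf t)$: (i) $v_x=e$, and $\partial_x^kv=0$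 for all $k\ge2$; (ii) $Q_1=Q_2=\dots=Q_{16}=0$; (iii) consequently, with $(c_1,\dots,c_{16})=\big(0,-\tfrac1{960},\tfrac1{5760},\tfrac1{1152},\tfrac1{2880},0,\tfrac1{1920},-\tfrac1{2880},-\tfrac1{1920},\tfrac1{1920},\tfrac1{1920},-\tfrac1{960},-\tfrac1{60},\tfrac1{48},-\tfrac7{240},\tfrac7{10}\big)$, for every function $G^{(2)}(u,u_x,u_{xx})$ the expression $\sum_{p=1}^{16}c_pQ_p+G^{(2)}(u,u_x,u_{xx})$ (which is the genus two free energy when $G^{(2)}$ is the genus two $G$-function) restricts to $G^{(2)}(u,u_x,u_{xx})\big|_{u_{i,x}=1,\;u_{i,xx}=0}$. -/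

import Mathlib

open scoped BigOperators

noncomputable section

namespace GenusTwo

/-! ### Frobenius manifolds in flat coordinates

Points are given by their flat coordinates `v = (v^α)`, `α : Fin n`.  The index `0 : Fin n` is the
distinguished direction (written `1` in the literature): the unit field is `e = ∂/∂v^0`, and the
spatial variable is `x = t^{0,0}`. -/

/-- The partial derivative `∂f/∂v^α` on the space of flat coordinates. -/
def pd {n : ℕ} (α : Fin n) (f : (Fin n → ℂ) → ℂ) (v : Fin n → ℂ) : ℂ :=
  fderiv ℂ f v (Pi.single α 1)

/-- A (complex) Frobenius manifold of dimension `n`, in a flat coordinate system: a potential `F`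
on an open domain, with constant flat metric `η`, associative product, unit `∂/∂v^0` and
Euler vector field `E^α = ∑_β Q^α_β v^β + r^α`. -/
structure FrobeniusManifold (n : ℕ) [NeZero n] where
  /-- the range of the flat coordinates -/
  dom : Set (Fin n → ℂ)
  isOpen_dom : IsOpen dom
  /-- the potential -/
  F : (Fin n → ℂ) → ℂ
  analytic_F : AnalyticOnNhd ℂ F dom
  /-- the Gram matrix `η_{αβ}` of the flat metric -/
  η : Matrix (Fin n) (Fin n) ℂ
  η_symm : η.IsSymm
  η_nondeg : IsUnit η.det
  unit_eq : ∀ v ∈ dom, ∀ α β, pd 0 (pd α (pd β F)) v = η α β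
  assoc : ∀ v ∈ dom, ∀ α β γ σ,
    ∑ δ, ∑ ε, pd α (pd β (pd δ F)) v * η⁻¹ δ ε * pd ε (pd γ (pd σ F)) v
      = ∑ δ, ∑ ε, pd γ (pd β (pd δ F)) v * η⁻¹ δ ε * pd ε (pd α (pd σ F)) v
  /-- the charge -/
  d : ℂ
  /-- the matrix `∂E^α/∂v^β` -/
  gradE : Matrix (Fin n) (Fin n) ℂ
  /-- the constant part of `E` -/
  constE : Fin n → ℂ
  gradE_unit : ∀ α, gradE α 0 = if α = 0 then 1 else 0
  /-- `E(F) = (3 - d) F` up to a polynomial of degree at most two -/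
  quasihomogeneous : ∃ (a : Fin n → Fin n → ℂ) (b : Fin n → ℂ) (c : ℂ), ∀ v ∈ dom,
    ∑ α, ((∑ β, gradE α β * v β) + constE α) * pd α F v
      = (3 - d) * F v + (∑ α, ∑ β, a α β * v α * v β + ∑ α, b α * v α + c)

namespace FrobeniusManifold

variable {n : ℕ} [NeZero n] (M : FrobeniusManifold n)

/-- The component `E^α` of the Euler vector field. -/
def euler (v : Fin n → ℂ) (α : Fin n) : ℂ := (∑ β, M.gradE α β * v β) + M.constE α

/-- The structure functions `c^γ_{αβ}`:  `∂_α · ∂_β = ∑_γ c^γ_{αβ} ∂_γ`. -/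
def mulCoeff (γ α β : Fin n) (v : Fin n → ℂ) : ℂ :=
  ∑ δ, M.η⁻¹ γ δ * pd δ (pd α (pd β M.F)) v

/-- The pairing `⟨∇f, ∇g⟩ = ∑ η^{αβ} ∂_α f ∂_β g` of gradients. -/
def gradPairing (f g : (Fin n → ℂ) → ℂ) (v : Fin n → ℂ) : ℂ :=
  ∑ α, ∑ β, M.η⁻¹ α β * pd α f v * pd β g v

/-- The constant matrix `V^α_β = (2 - d)/2 δ^α_β - ∂E^α/∂v^β`. -/
def antisymV : Matrix (Fin n) (Fin n) ℂ := ((2 - M.d) / 2) • 1 - M.gradE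

end FrobeniusManifold

/-! ### Semisimplicity: canonical coordinates, Lamé and rotation coefficients, `G`-function -/

/-- The Jacobian matrix `∂u_i/∂v^α` of a tuple of functions. -/
def jacobian {n : ℕ} (u : (Fin n → ℂ) → Fin n → ℂ) (v : Fin n → ℂ) : Matrix (Fin n) (Fin n) ℂ :=
  Matrix.of fun i α => pd α (fun w => u w i) v

/-- Canonical coordinates `u_1, …, u_n` on a semisimple Frobenius manifold, together with a choice
`h_i` of the square roots of the diagonal entries `η_{ii}` of the metric (Lamé coefficients).  The
entry `(jacobian u v)⁻¹ α i` is `∂v^α/∂u_i`. -/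
structure CanonicalCoordinates {n : ℕ} [NeZero n] (M : FrobeniusManifold n) where
  u : (Fin n → ℂ) → Fin n → ℂ
  analytic_u : AnalyticOnNhd ℂ u M.dom
  jacobian_nondeg : ∀ v ∈ M.dom, IsUnit (jacobian u v).det
  /-- `∂/∂u_i · ∂/∂u_j = δ_{ij} ∂/∂u_i` -/
  idempotent : ∀ v ∈ M.dom, ∀ i j α,
    ∑ β, ∑ γ, M.mulCoeff α β γ v * (jacobian u v)⁻¹ β i * (jacobian u v)⁻¹ γ j
      = if i = j then (jacobian u v)⁻¹ α i else 0
  /-- `E = ∑_i u_i ∂/∂u_i` -/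
  euler_eq : ∀ v ∈ M.dom, ∀ α, M.euler v α = ∑ i, u v i * (jacobian u v)⁻¹ α i
  h : (Fin n → ℂ) → Fin n → ℂ
  analytic_h : AnalyticOnNhd ℂ h M.dom
  /-- `h_i² = ⟨∂/∂u_i, ∂/∂u_i⟩` -/
  h_sq : ∀ v ∈ M.dom, ∀ i,
    h v i ^ 2 = ∑ α, ∑ β, M.η α β * (jacobian u v)⁻¹ α i * (jacobian u v)⁻¹ β i

namespace CanonicalCoordinates

variable {n : ℕ} [NeZero n] {M : FrobeniusManifold n} (C : CanonicalCoordinates M)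

/-- The derivative `∂f/∂u_i = ∑_α (∂v^α/∂u_i) ∂f/∂v^α`. -/
def pdu (i : Fin n) (f : (Fin n → ℂ) → ℂ) (v : Fin n → ℂ) : ℂ :=
  ∑ α, (jacobian C.u v)⁻¹ α i * pd α f v

/-- The rotation coefficients `γ_{ij} = h_i⁻¹ ∂h_j/∂u_i` for `i ≠ j`, and `γ_{ii} = 0`. -/
def rotation (i j : Fin n) (v : Fin n → ℂ) : ℂ :=
  if i = j then 0 else (C.h v i)⁻¹ * C.pdu i (fun w => C.h w j) v

/-- `G` is a `G`-function of the Frobenius manifold: it is given, up to a constant, by the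
quadrature
`∂G/∂u_i = ½ ∑_{j≠i} (u_i - u_j) γ_{ij}² - (1/24) ∑_{k≠i} γ_{ik} (h_i/h_k - h_k/h_i)`. -/
structure IsGFunction (G : (Fin n → ℂ) → ℂ) : Prop where
  analytic : AnalyticOnNhd ℂ G M.dom
  quadrature : ∀ v ∈ M.dom, ∀ i,
    C.pdu i G v
      = 1 / 2 * ∑ j ∈ Finset.univ.erase i, (C.u v i - C.u v j) * C.rotation i j v ^ 2
        - 1 / 24 * ∑ k ∈ Finset.univ.erase i,
            C.rotation i k v * (C.h v i / C.h v k - C.h v k / C.h v i)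

end CanonicalCoordinates

/-! ### Calibration -/

/-- A calibration: flat coordinates `θ_α(v; z) = ∑_p θ_{α,p}(v) z^p` of the deformed flat
connection, normalised by the monodromy data `μ, R_0, R_1, …` at `z = 0`.  Matrices are indexed with
the upper index as row and the lower index as column. -/
structure Calibration {n : ℕ} [NeZero n] (M : FrobeniusManifold n) where
  θ : Fin n → ℕ → (Fin n → ℂ) → ℂ
  analytic_θ : ∀ α p, AnalyticOnNhd ℂ (θ α p) M.dom
  θ_zero : ∀ v ∈ M.dom, ∀ α, θ α 0 v = ∑ γ, M.η α γ * v γ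
  θ_one : ∀ v ∈ M.dom, ∀ α, θ α 1 v = pd α M.F v
  /-- `⟨∇θ_α(v; -z), ∇θ_β(v; z)⟩ = η_{αβ}`, coefficient by coefficient in `z` -/
  orthogonality : ∀ v ∈ M.dom, ∀ α β m,
    ∑ k ∈ Finset.range (m + 1), (-1 : ℂ) ^ k * M.gradPairing (θ α k) (θ β (m - k)) v
      = if m = 0 then M.η α β else 0
  /-- `∂_α ∂_β θ_γ(v; z) = z ∑_ξ c^ξ_{αβ} ∂_ξ θ_γ(v; z)`; the coefficient of `z^0` vanishes by
  `θ_zero` -/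
  flatness : ∀ v ∈ M.dom, ∀ α β γ p,
    pd α (pd β (θ γ (p + 1))) v = ∑ ξ, M.mulCoeff ξ α β v * pd ξ (θ γ p) v
  μ : Matrix (Fin n) (Fin n) ℂ
  R : ℕ → Matrix (Fin n) (Fin n) ℂ
  V_eq : M.antisymV = μ + R 0
  μ_semisimple : Module.End.IsSemisimple (Matrix.toLin' μ)
  R_zero_nilpotent : IsNilpotent (R 0)
  R_eventually_zero : ∃ m, ∀ k, m < k → R k = 0
  R_symm : ∀ k α β,
    ∑ γ, R k γ α * M.η γ β = (-1 : ℂ) ^ (k + 1) * ∑ γ, R k γ β * M.η γ α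
  R_comm : ∀ k, μ * R k - R k * μ = (k : ℂ) • R k
  homogeneity : ∀ v ∈ M.dom, ∀ α β p,
    ∑ ε, M.euler v ε * pd ε (pd β (θ α p)) v
      = (p : ℂ) * pd β (θ α p) v
        + ∑ γ, μ γ α * pd β (θ γ p) v + ∑ γ, μ γ β * pd γ (θ α p) v
        + ∑ γ, R 0 γ β * pd γ (θ α p) v
        + ∑ k ∈ Finset.range (p + 1), ∑ γ, pd β (θ γ (p - k)) v * R k γ α

namespace Calibration

variable {n : ℕ} [NeZero n] {M : FrobeniusManifold n} (Θ : Calibration M)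

/-- The two-point functions `Ω_{α,p;β,q}`, with generating function
`∑ Ω_{α,p;β,q} z^p w^q = (⟨∇θ_α(z), ∇θ_β(w)⟩ - η_{αβ}) / (z + w)`, that is
`Ω_{α,p;β,q} = ∑_{k=0}^q (-1)^k ⟨∇θ_{α,p+1+k}, ∇θ_{β,q-k}⟩`. -/
def twoPoint (a b : Fin n × ℕ) (v : Fin n → ℂ) : ℂ :=
  ∑ k ∈ Finset.range (b.2 + 1),
    (-1 : ℂ) ^ k * M.gradPairing (Θ.θ a.1 (a.2 + 1 + k)) (Θ.θ b.1 (b.2 - k)) v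

end Calibration

/-! ### The big phase space -/

/-- The big phase space, with coordinates `t^{α,p}`; only finitely many of the times of a point are
nonzero, so that the sums over all times below are finite. -/
abbrev BigPhase (n : ℕ) : Type := (Fin n × ℕ) →₀ ℂ

/-- The small phase space `t^{γ,p} = 0` for all `p > 0`. -/
def smallPhase (n : ℕ) : Set (BigPhase n) := {t | ∀ γ p, 0 < p → t (γ, p) = 0}

/-- The point of the big phase space with given times `t^{α,p}`, `p < N`, all others being `0`. -/
def truncated {n : ℕ} (N : ℕ) (s : Fin n × Fin N → ℂ) : BigPhase n :=
  ∑ a, Finsupp.single (a.1, (a.2 : ℕ)) (s a)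

/-- The dilaton shift `t̃^{α,p} = t^{α,p} - δ^α_0 δ^p_1` (with `0` the unit direction). -/
def dilatonShift {n : ℕ} [NeZero n] (t : BigPhase n) : BigPhase n :=
  t - Finsupp.single (0, 1) 1

/-- The partial derivative `∂f/∂t^{α,0}` on the big phase space. -/
def pt {n : ℕ} (α : Fin n) (f : BigPhase n → ℂ) (t : BigPhase n) : ℂ :=
  lineDeriv ℂ f t (Finsupp.single (α, 0) 1)

/-- The iterated derivative `∂^m f / ∂t^{α_1,0} ⋯ ∂t^{α_m,0}`. -/
def ptList {n : ℕ} : List (Fin n) → (BigPhase n → ℂ) → BigPhase n → ℂ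
  | [], f => f
  | α :: l, f => pt α (ptList l f)

/-- The topological solution `v(t)` of the principal hierarchy: on a region of the big phase space
which is open in every finite set of times, a holomorphic solution of
`∑_{α,p} t̃^{α,p} ∇θ_{α,p}(v) = 0`. -/
structure TopologicalSolution {n : ℕ} [NeZero n] {M : FrobeniusManifold n}
    (Θ : Calibration M) where
  dom : Set (BigPhase n)
  isOpen_dom : ∀ N, IsOpen {s : Fin n × Fin N → ℂ | truncated N s ∈ dom}
  v : BigPhase n → Fin n → ℂ
  mapsTo : ∀ t ∈ dom, v t ∈ M.dom
  analytic_v : ∀ N, AnalyticOnNhd ℂ (fun s : Fin n × Fin N → ℂ => v (truncated N s))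
    {s | truncated N s ∈ dom}
  eulerLagrange : ∀ t ∈ dom, ∀ γ,
    (dilatonShift t).sum (fun a c => c * pd γ (Θ.θ a.1 a.2) (v t)) = 0

namespace TopologicalSolution

variable {n : ℕ} [NeZero n] {M : FrobeniusManifold n} {Θ : Calibration M}
  (S : TopologicalSolution Θ)

/-- The genus zero free energy `𝓕₀(t) = ½ ∑ Ω_{α,p;β,q}(v(t)) t̃^{α,p} t̃^{β,q}`. -/
def freeEnergyZero (t : BigPhase n) : ℂ :=
  1 / 2 * (dilatonShift t).sum fun a x =>
    (dilatonShift t).sum fun b y => x * y * Θ.twoPoint a b (S.v t)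

/-- The `k`-th jet `∂_x^k v^α` of the topological solution, `x = t^{0,0}`. -/
def jetV (k : ℕ) (t : BigPhase n) (α : Fin n) : ℂ :=
  ptList (List.replicate k 0) (fun r => S.v r α) t

/-- The `k`-th jet `∂_x^k u_i` of the canonical coordinates along the topological solution. -/
def jetU (C : CanonicalCoordinates M) (k : ℕ) (t : BigPhase n) (i : Fin n) : ℂ :=
  ptList (List.replicate k 0) (fun r => C.u (S.v r) i) t

/-- The genus one free energy `𝓕₁ = (1/24) ∑_i log u_{i,x} + G`, evaluated on the topological
solution. -/
def freeEnergyOne (C : CanonicalCoordinates M) (G : (Fin n → ℂ) → ℂ) (t : BigPhase n) : ℂ :=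
  1 / 24 * ∑ i, Complex.log (S.jetU C 1 t i) + G (S.v t)

/-- The matrix `M_{αβ} = ∂³𝓕₀ / ∂t^{0,0} ∂t^{α,0} ∂t^{β,0}`. -/
def matrixM (t : BigPhase n) : Matrix (Fin n) (Fin n) ℂ :=
  Matrix.of fun α β => ptList [0, α, β] S.freeEnergyZero t

end TopologicalSolution

/-! ### Dual graphs and their contributions -/

/-- A dual graph with vertices of genus `0` (bullets) or `1` (circles): the list of its edges, given
by their end points, and the number of legs at each vertex. -/
structure DualGraph where
  numVertices : ℕ
  genus : Fin numVertices → Fin 2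
  edges : List (Fin numVertices × Fin numVertices)
  legs : Fin numVertices → ℕ

/-- The list of the indices carried by the half-edges at the vertex `w`, when the two halves of the
edge number `j` carry the indices `(idx j).1` and `(idx j).2`. -/
def DualGraph.halfEdgeIndices (Γ : DualGraph) {n : ℕ} (idx : Fin Γ.edges.length → Fin n × Fin n)
    (w : Fin Γ.numVertices) : List (Fin n) :=
  (List.finRange Γ.edges.length).flatMap fun j =>
    (if (Γ.edges.get j).1 = w then [(idx j).1] else []) ++
      (if (Γ.edges.get j).2 = w then [(idx j).2] else [])

/-- The contribution of a dual graph: a vertex of genus `g` is `𝓕_g`, a leg is `∂/∂t^{0,0}`, an edge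
is `∑ (M⁻¹)^{αα'} ∂/∂t^{α,0} ⊗ ∂/∂t^{α',0}`; the derivatives act on the vertices first, and the
contractions with `M⁻¹` are carried out at the end. -/
def DualGraph.contribution (Γ : DualGraph) {n : ℕ} [NeZero n] {M : FrobeniusManifold n}
    {Θ : Calibration M} (S : TopologicalSolution Θ) (C : CanonicalCoordinates M)
    (G : (Fin n → ℂ) → ℂ) (t : BigPhase n) : ℂ :=
  ∑ idx : Fin Γ.edges.length → Fin n × Fin n,
    (∏ j, (S.matrixM t)⁻¹ (idx j).1 (idx j).2) *
      ∏ w, ptList (Γ.halfEdgeIndices idx w ++ List.replicate (Γ.legs w) 0)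
        (if Γ.genus w = 0 then S.freeEnergyZero else S.freeEnergyOne C G) t

/-- The sixteen dual graphs; `sixteenGraphs p` is the graph of `Q_{p+1}`. -/
def sixteenGraphs : Fin 16 → DualGraph := ![
  ⟨1, ![0], [(0, 0), (0, 0)], ![2]⟩,
  ⟨2, ![0, 0], [(0, 1), (0, 1), (0, 1)], ![1, 2]⟩,
  ⟨2, ![0, 0], [(0, 0), (0, 1), (0, 1)], ![1, 2]⟩,
  ⟨3, ![0, 0, 0], [(0, 1), (0, 1), (0, 2), (1, 2)], ![1, 1, 2]⟩,
  ⟨2, ![0, 0], [(0, 0), (0, 1), (0, 1)], ![0, 3]⟩,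
  ⟨2, ![0, 0], [(0, 1), (0, 1), (0, 1)], ![0, 3]⟩,
  ⟨3, ![0, 0, 0], [(0, 1), (0, 1), (0, 2), (0, 2)], ![0, 2, 2]⟩,
  ⟨3, ![0, 0, 0], [(0, 1), (0, 1), (0, 2), (1, 2)], ![1, 0, 3]⟩,
  ⟨3, ![0, 0, 0], [(0, 0), (0, 1), (1, 2), (2, 0)], ![0, 2, 2]⟩,
  ⟨3, ![0, 0, 0], [(0, 1), (0, 1), (0, 2), (1, 2)], ![2, 0, 2]⟩,
  ⟨4, ![0, 0, 0, 0], [(0, 1), (0, 1), (0, 2), (2, 3), (3, 1)], ![1, 0, 2, 2]⟩,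
  ⟨4, ![0, 0, 0, 0], [(0, 1), (0, 2), (2, 1), (0, 3), (3, 1)], ![1, 0, 2, 2]⟩,
  ⟨2, ![0, 1], [(0, 1), (0, 1)], ![2, 0]⟩,
  ⟨1, ![1], [(0, 0)], ![1]⟩,
  ⟨2, ![0, 1], [(0, 0), (0, 1)], ![1, 1]⟩,
  ⟨2, ![1, 1], [(0, 1)], ![1, 0]⟩]

/-- The term `Q_{p+1}`, as a function on the big phase space. -/
def termQ {n : ℕ} [NeZero n] {M : FrobeniusManifold n} {Θ : Calibration M}
    (S : TopologicalSolution Θ) (C : CanonicalCoordinates M) (G : (Fin n → ℂ) → ℂ)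
    (p : Fin 16) (t : BigPhase n) : ℂ :=
  (sixteenGraphs p).contribution S C G t

/-- The constants `c_1, …, c_16` of the genus two decomposition. -/
def coeffC : Fin 16 → ℂ := ![0, -1 / 960, 1 / 5760, 1 / 1152, 1 / 2880, 0, 1 / 1920, -1 / 2880,
  -1 / 1920, 1 / 1920, 1 / 1920, -1 / 960, -1 / 60, 1 / 48, -7 / 240, 7 / 10]

/-- The genus two decomposition `∑_p c_p Q_p + G₂(u, u_x, u_xx)`, on the big phase space, for a
function `G₂` of the two-jets of the canonical coordinates. -/
def genusTwoDecomposition {n : ℕ} [NeZero n] {M : FrobeniusManifold n} {Θ : Calibration M}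
    (S : TopologicalSolution Θ) (C : CanonicalCoordinates M) (G : (Fin n → ℂ) → ℂ)
    (G₂ : (Fin n → ℂ) → (Fin n → ℂ) → (Fin n → ℂ) → ℂ) (t : BigPhase n) : ℂ :=
  ∑ p, coeffC p * termQ S C G p t + G₂ (S.jetU C 0 t) (S.jetU C 1 t) (S.jetU C 2 t)

end GenusTwo

end

/-! On the small phase space the Euler–Lagrange equation becomes `∑ η_{αγ} t^{α,0} = ∂_γ ∂_0 F(v)`.
Since `∂_δ ∂_γ ∂_0 F = η_{δγ}`, differentiating gives `∂v^δ/∂t^{α,0} = δ^δ_α`: derivatives along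
`t^{α,0}` are derivatives along `v^α`, and `∂_x` is `∂_e`.

In genus zero, `t̃ ↦ 𝓕₀` is a quadratic form whose coefficients `Ω(v)` contribute nothing to its
first two derivatives, by the Euler–Lagrange equation. Hence the third derivatives are `∂_α ∂_β ∂_γ
F`. With one unit index they equal the constant `η`, so every correlator with at least four entries,
one of them the unit, vanishes (`ptList_freeEnergyZero_eq_zero`).

In genus one, `u_{i,x} = ∂_e u_i = 1` kills the logarithms and `𝓕₁ = G(v)`. Summing the quadrature
over `i` gives `∂_e G` as antisymmetric double sums, because `γ_{ij}` is symmetric: `∑ h_i² du_i` is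
closed, being the differential of the lowered coordinate `∑ η_{0β} v^β`. So genus one correlators
containing the unit vanish too (`ptList_freeEnergyOne_eq_zero`).

Each of the sixteen graphs has a vertex with a leg that is of genus one or of valence at least four,
so each contribution has a zero factor. -/

namespace GenusTwo

/-! ### Coordinate derivatives of analytic functions. -/

section Calculus

variable {n : ℕ} {U : Set (Fin n → ℂ)} {f g : (Fin n → ℂ) → ℂ} {w : Fin n → ℂ}

lemma pd_congr (hU : IsOpen U) (h : Set.EqOn f g U) (hw : w ∈ U) (α : Fin n) :
    pd α f w = pd α g w := by
  unfold pd
  rw [(Filter.eventuallyEq_of_mem (hU.mem_nhds hw) h).fderiv_eq]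

lemma analyticOnNhd_pd (hf : AnalyticOnNhd ℂ f U) (α : Fin n) : AnalyticOnNhd ℂ (pd α f) U :=
  fun w hw => ((ContinuousLinearMap.apply ℂ ℂ (Pi.single α (1 : ℂ) : Fin n → ℂ)).analyticAt _).comp
    (hf.fderiv w hw)

lemma pd_const (α : Fin n) (c : ℂ) : pd α (fun _ => c) w = 0 := by
  simp [pd]

lemma pd_add (hf : DifferentiableAt ℂ f w) (hg : DifferentiableAt ℂ g w) (α : Fin n) :
    pd α (fun x => f x + g x) w = pd α f w + pd α g w := by
  simp [pd, fderiv_fun_add hf hg]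

lemma pd_mul (hf : DifferentiableAt ℂ f w) (hg : DifferentiableAt ℂ g w) (α : Fin n) :
    pd α (fun x => f x * g x) w = pd α f w * g w + f w * pd α g w := by
  simp [pd, fderiv_fun_mul hf hg]; ring

lemma pd_const_mul (hf : DifferentiableAt ℂ f w) (α : Fin n) (c : ℂ) :
    pd α (fun x => c * f x) w = c * pd α f w := by
  rw [pd_mul (by fun_prop) hf, pd_const]; ring

lemma pd_sum {ι : Type*} {s : Finset ι} {F : ι → (Fin n → ℂ) → ℂ}
    (hF : ∀ i ∈ s, DifferentiableAt ℂ (F i) w) (α : Fin n) :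
    pd α (fun x => ∑ i ∈ s, F i x) w = ∑ i ∈ s, pd α (F i) w := by
  simp [pd, fderiv_fun_sum hF]

lemma pd_comm (hf : AnalyticOnNhd ℂ f U) (hw : w ∈ U) (α β : Fin n) :
    pd α (pd β f) w = pd β (pd α f) w := by
  have hd : DifferentiableAt ℂ (fderiv ℂ f) w := (hf.fderiv w hw).differentiableAt
  have key : ∀ α β : Fin n, pd α (pd β f) w
      = fderiv ℂ (fderiv ℂ f) w (Pi.single α 1) (Pi.single β 1) := by
    intro α β
    have : pd β f = fun x => fderiv ℂ f x (Pi.single β 1) := rfl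
    rw [this]
    unfold pd
    rw [fderiv_clm_apply hd (by fun_prop)]
    simp
  have hs : IsSymmSndFDerivAt ℂ f w :=
    ((hf w hw).contDiffAt (n := 2)).isSymmSndFDerivAt (by simp)
  rw [key, key, hs.eq]

lemma pd_comp {V : (Fin n → ℂ) → Fin n → ℂ} (hg : DifferentiableAt ℂ g (V w))
    (hV : DifferentiableAt ℂ V w) (α : Fin n) :
    pd α (fun x => g (V x)) w = ∑ δ, pd α (fun x => V x δ) w * pd δ g (V w) := by
  have h1 : pd α (fun x => g (V x)) w = fderiv ℂ g (V w) (fderiv ℂ V w (Pi.single α 1)) := by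
    unfold pd
    rw [show (fun x => g (V x)) = g ∘ V from rfl, fderiv_comp w hg hV]
    rfl
  have h2 : ∀ δ, pd α (fun x => V x δ) w = fderiv ℂ V w (Pi.single α 1) δ := by
    intro δ
    unfold pd
    rw [fderiv_apply hV]
    rfl
  rw [h1]
  refine (LinearMap.pi_apply_eq_sum_univ (fderiv ℂ g (V w)).toLinearMap _).trans ?_
  refine Finset.sum_congr rfl fun δ _ => ?_
  rw [h2, pd, smul_eq_mul, ContinuousLinearMap.coe_coe]
  congr 2
  funext j
  simp [Pi.single_apply, eq_comm]

end Calculus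

/-! ### The Egoroff metric and the invariance of the `G`-function along the unit. -/

section Semisimple

variable {n : ℕ} [NeZero n] {M : FrobeniusManifold n} {v : Fin n → ℂ}

namespace FrobeniusManifold

lemma η_inv_symm (M : FrobeniusManifold n) : M.η⁻¹.IsSymm := M.η_symm.inv

lemma pd_three_swap_left (hv : v ∈ M.dom) (α β γ : Fin n) :
    pd α (pd β (pd γ M.F)) v = pd β (pd α (pd γ M.F)) v :=
  pd_comm (analyticOnNhd_pd M.analytic_F γ) hv α β

lemma pd_three_swap_right (hv : v ∈ M.dom) (α β γ : Fin n) :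
    pd α (pd β (pd γ M.F)) v = pd α (pd γ (pd β M.F)) v :=
  pd_congr M.isOpen_dom (fun _ hx => pd_comm M.analytic_F hx β γ) hv α

lemma unit_right (hv : v ∈ M.dom) (α β : Fin n) : pd α (pd β (pd 0 M.F)) v = M.η α β := by
  rw [pd_three_swap_right hv, pd_three_swap_left hv, M.unit_eq v hv]

lemma sum_η_mulCoeff (κ α β : Fin n) :
    ∑ γ, M.η κ γ * M.mulCoeff γ α β v = pd κ (pd α (pd β M.F)) v := by
  have h : M.η * M.η⁻¹ = 1 := Matrix.mul_nonsing_inv _ M.η_nondeg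
  have := congrFun (congrArg (fun A : Matrix (Fin n) (Fin n) ℂ =>
    A.mulVec fun δ => pd δ (pd α (pd β M.F)) v) h) κ
  rw [← Matrix.mulVec_mulVec, Matrix.one_mulVec] at this
  exact this

end FrobeniusManifold

namespace CanonicalCoordinates

variable (C : CanonicalCoordinates M)

lemma jacobian_mul_inv (hv : v ∈ M.dom) : jacobian C.u v * (jacobian C.u v)⁻¹ = 1 :=
  Matrix.mul_nonsing_inv _ (C.jacobian_nondeg v hv)

lemma inv_mul_jacobian (hv : v ∈ M.dom) : (jacobian C.u v)⁻¹ * jacobian C.u v = 1 :=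
  Matrix.nonsing_inv_mul _ (C.jacobian_nondeg v hv)

/-- `⟨∂/∂u_i, ∂/∂u_j⟩ = δ_{ij} ⟨e, ∂/∂u_i⟩`. -/
lemma metric_offdiag (hv : v ∈ M.dom) (i j : Fin n) :
    ∑ β, ∑ γ, M.η β γ * (jacobian C.u v)⁻¹ β i * (jacobian C.u v)⁻¹ γ j
      = if i = j then ∑ α, M.η 0 α * (jacobian C.u v)⁻¹ α i else 0 := by
  -- The idempotent relation is paired with the unit field; `⟨e, X · Y⟩ = ⟨X, Y⟩` turns it into the
  -- metric.
  have h : ∑ α, M.η 0 α * ∑ β, ∑ γ, M.mulCoeff α β γ v * (jacobian C.u v)⁻¹ β i *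
      (jacobian C.u v)⁻¹ γ j = ∑ α, M.η 0 α * if i = j then (jacobian C.u v)⁻¹ α i else 0 :=
    Finset.sum_congr rfl fun α _ => by rw [C.idempotent v hv]
  have h2 : (∑ α, M.η 0 α * if i = j then (jacobian C.u v)⁻¹ α i else 0)
      = if i = j then ∑ α, M.η 0 α * (jacobian C.u v)⁻¹ α i else 0 := by
    split_ifs <;> simp
  rw [← h2, ← h]
  simp only [Finset.mul_sum]
  conv_rhs => rw [Finset.sum_comm]
  refine Finset.sum_congr rfl fun β _ => ?_
  conv_rhs => rw [Finset.sum_comm]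
  refine Finset.sum_congr rfl fun γ _ => ?_
  rw [← M.unit_eq v hv, ← FrobeniusManifold.sum_η_mulCoeff, Finset.sum_mul, Finset.sum_mul]
  exact Finset.sum_congr rfl fun α _ => by ring

lemma h_sq_eq (hv : v ∈ M.dom) (i : Fin n) :
    C.h v i ^ 2 = ∑ α, M.η 0 α * (jacobian C.u v)⁻¹ α i := by
  rw [C.h_sq v hv, C.metric_offdiag hv, if_pos rfl]

lemma metric_eq_diagonal (hv : v ∈ M.dom) :
    ((jacobian C.u v)⁻¹).transpose * M.η * (jacobian C.u v)⁻¹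
      = Matrix.diagonal fun i => C.h v i ^ 2 := by
  ext i j
  rw [Matrix.diagonal_apply, C.h_sq_eq hv, ← C.metric_offdiag hv, Finset.sum_comm]
  simp only [Matrix.mul_apply, Matrix.transpose_apply, Finset.sum_mul]
  exact Finset.sum_congr rfl fun β _ => Finset.sum_congr rfl fun γ _ => by ring

/-- The `h_i²` are the diagonal entries of the Gram matrix in the frame `∂/∂u_i`, which is
nondegenerate. -/
lemma h_ne_zero (hv : v ∈ M.dom) (i : Fin n) : C.h v i ≠ 0 := by
  have h : IsUnit (Matrix.diagonal fun i => C.h v i ^ 2).det := by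
    rw [← C.metric_eq_diagonal hv, Matrix.det_mul, Matrix.det_mul, Matrix.det_transpose]
    have := Matrix.isUnit_nonsing_inv_det _ (C.jacobian_nondeg v hv)
    exact (this.mul M.η_nondeg).mul this
  rw [Matrix.det_diagonal, isUnit_iff_ne_zero, Finset.prod_ne_zero_iff] at h
  exact fun h0 => h i (Finset.mem_univ i) (by simp [h0])

/-- The metric in flat coordinates, paired with the unit field: `dt_0 = ∑_i h_i² du_i`. -/
lemma sum_jacobian_h_sq (hv : v ∈ M.dom) (β : Fin n) :
    ∑ i, pd β (fun x => C.u x i) v * C.h v i ^ 2 = M.η 0 β := by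
  have h : (M.η * (jacobian C.u v)⁻¹ * jacobian C.u v) 0 β = M.η 0 β := by
    rw [Matrix.mul_assoc, C.inv_mul_jacobian hv, Matrix.mul_one]
  rw [← h, Matrix.mul_apply]
  refine Finset.sum_congr rfl fun i _ => ?_
  rw [C.h_sq_eq hv, Matrix.mul_apply, mul_comm]
  rfl

/-- `e = ∑_i ∂/∂u_i`, i.e. `∂_e u_i = 1`. -/
lemma pd_zero_u (hv : v ∈ M.dom) (i : Fin n) : pd 0 (fun x => C.u x i) v = 1 := by
  have h : M.η * (jacobian C.u v)⁻¹
      = (jacobian C.u v).transpose * Matrix.diagonal fun i => C.h v i ^ 2 := by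
    rw [← C.metric_eq_diagonal hv, ← Matrix.mul_assoc, ← Matrix.mul_assoc, ← Matrix.transpose_mul,
      C.inv_mul_jacobian hv, Matrix.transpose_one, Matrix.one_mul]
  -- The `(0, i)` entry reads `h_i² = ∂_0 u_i · h_i²`.
  have h0 := congrFun (congrFun h 0) i
  rw [Matrix.mul_diagonal, Matrix.mul_apply, ← C.h_sq_eq hv, Matrix.transpose_apply] at h0
  exact mul_right_cancel₀ (pow_ne_zero 2 (C.h_ne_zero hv i)) (by rw [one_mul]; exact h0.symm)

lemma analyticOnNhd_u (i : Fin n) : AnalyticOnNhd ℂ (fun x => C.u x i) M.dom :=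
  fun x hx => analyticAt_pi_iff.1 (C.analytic_u x hx) i

lemma analyticOnNhd_h (i : Fin n) : AnalyticOnNhd ℂ (fun x => C.h x i) M.dom :=
  fun x hx => analyticAt_pi_iff.1 (C.analytic_h x hx) i

lemma sum_pdu (hv : v ∈ M.dom) (f : (Fin n → ℂ) → ℂ) : ∑ i, C.pdu i f v = pd 0 f v := by
  have h : ∀ α, ∑ i, (jacobian C.u v)⁻¹ α i = if α = 0 then 1 else 0 := by
    intro α
    have := congrFun (congrFun (C.inv_mul_jacobian hv) α) 0
    rw [Matrix.mul_apply, Matrix.one_apply] at this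
    rw [← this]
    refine Finset.sum_congr rfl fun i _ => ?_
    rw [show jacobian C.u v i 0 = 1 from C.pd_zero_u hv i, mul_one]
  unfold pdu
  rw [Finset.sum_comm]
  simp [← Finset.sum_mul, h]

/-- Closedness of `∑ h_i² du_i`: its component along `v^β` is the constant `η_{0β}`, so its
`γ`-derivative vanishes; the part with second derivatives of `u_i` is symmetric in `β, γ`, hence so
is the rest. -/
lemma sum_jacobian_h_pd_symm (hv : v ∈ M.dom) (β γ : Fin n) :
    ∑ i, pd β (fun x => C.u x i) v * (C.h v i * pd γ (fun x => C.h x i) v)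
      = ∑ i, pd γ (fun x => C.u x i) v * (C.h v i * pd β (fun x => C.h x i) v) := by
  have hu := fun i => C.analyticOnNhd_u i
  have hh := fun i => C.analyticOnNhd_h i
  have key : ∀ β γ : Fin n, ∑ i, pd γ (pd β (fun x => C.u x i)) v * C.h v i ^ 2
      + 2 * ∑ i, pd β (fun x => C.u x i) v * (C.h v i * pd γ (fun x => C.h x i) v) = 0 := by
    intro β γ
    have hc : pd γ (fun x => ∑ i, pd β (fun x => C.u x i) x * (C.h x i * C.h x i)) v = 0 := by
      rw [pd_congr M.isOpen_dom (g := fun _ => M.η 0 β) (fun x hx => ?_) hv, pd_const]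
      simp only [← pow_two]
      exact C.sum_jacobian_h_sq hx β
    have h1 := fun i => (analyticOnNhd_pd (hu i) β v hv).differentiableAt
    have h2 := fun i => (hh i v hv).differentiableAt
    rw [pd_sum fun i _ => (h1 i).fun_mul ((h2 i).fun_mul (h2 i))] at hc
    rw [← hc, Finset.mul_sum, ← Finset.sum_add_distrib]
    refine Finset.sum_congr rfl fun i _ => ?_
    rw [pd_mul (h1 i) ((h2 i).fun_mul (h2 i)), pd_mul (h2 i) (h2 i)]
    ring
  have e1 := key β γ
  have e2 := key γ β
  rw [Finset.sum_congr rfl fun i _ => by rw [pd_comm (hu i) hv γ β]] at e1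
  have := e1.trans e2.symm
  exact mul_left_cancel₀ two_ne_zero (add_left_cancel this)

/-- Contracting a derivative with `∂/∂u_j`. -/
lemma sum_inv_jacobian_contract (hv : v ∈ M.dom) (j : Fin n) (a : Fin n → ℂ) :
    ∑ β, (jacobian C.u v)⁻¹ β j * ∑ i, pd β (fun x => C.u x i) v * a i = a j := by
  have h : ∀ i, ∑ β, (jacobian C.u v)⁻¹ β j * pd β (fun x => C.u x i) v
      = if i = j then 1 else 0 := by
    intro i
    have := congrFun (congrFun (C.jacobian_mul_inv hv) i) j
    rw [Matrix.mul_apply, Matrix.one_apply] at this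
    rw [← this]
    exact Finset.sum_congr rfl fun β _ => mul_comm _ _
  simp only [Finset.mul_sum, ← mul_assoc]
  rw [Finset.sum_comm]
  simp [← Finset.sum_mul, h]

/-- The Egoroff property `∂_i h_j² = ∂_j h_i²`, obtained by contracting the closedness relation with
`∂/∂u_i` and `∂/∂u_j`. -/
lemma h_mul_pdu_h_symm (hv : v ∈ M.dom) (i j : Fin n) :
    C.h v j * C.pdu i (fun x => C.h x j) v = C.h v i * C.pdu j (fun x => C.h x i) v := by
  have key : ∀ i j : Fin n, C.h v j * C.pdu i (fun x => C.h x j) v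
      = ∑ γ, ∑ β, (jacobian C.u v)⁻¹ γ i * (jacobian C.u v)⁻¹ β j *
        ∑ k, pd β (fun x => C.u x k) v * (C.h v k * pd γ (fun x => C.h x k) v) := by
    intro i j
    simp only [mul_assoc, ← Finset.mul_sum]
    rw [pdu, Finset.mul_sum]
    refine Finset.sum_congr rfl fun γ _ => ?_
    rw [C.sum_inv_jacobian_contract hv j fun k => C.h v k * pd γ (fun x => C.h x k) v]
    ring
  rw [key, key, Finset.sum_comm]
  refine Finset.sum_congr rfl fun γ _ => Finset.sum_congr rfl fun β _ => ?_
  rw [C.sum_jacobian_h_pd_symm hv γ β]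
  ring

/-- The Egoroff identity divided by `h_i h_j`. -/
lemma rotation_symm (hv : v ∈ M.dom) (i j : Fin n) : C.rotation i j v = C.rotation j i v := by
  unfold rotation
  by_cases hij : i = j
  · simp [hij]
  · rw [if_neg hij, if_neg (Ne.symm hij)]
    have := C.h_mul_pdu_h_symm hv i j
    have hi := C.h_ne_zero hv i
    have hj := C.h_ne_zero hv j
    field_simp
    linear_combination this

end CanonicalCoordinates

lemma sum_sum_erase_eq_zero {ι : Type*} [Fintype ι] [DecidableEq ι] {a : ι → ι → ℂ}
    (ha : ∀ i j, a i j = -a j i) : ∑ i, ∑ j ∈ Finset.univ.erase i, a i j = 0 := by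
  have hd : ∀ i, a i i = 0 := fun i => by linear_combination (1 / 2 : ℂ) * ha i i
  have h1 : ∀ i, ∑ j ∈ Finset.univ.erase i, a i j = ∑ j, a i j := fun i =>
    Finset.sum_erase _ (hd i)
  simp only [h1]
  have h2 : ∑ i, ∑ j, a i j = -∑ i, ∑ j, a i j := by
    conv_lhs => rw [Finset.sum_comm]
    simp only [← Finset.sum_neg_distrib]
    exact Finset.sum_congr rfl fun i _ => Finset.sum_congr rfl fun j _ => ha j i
  linear_combination (1 / 2 : ℂ) * h2

/-- The `G`-function is constant along the unit field. -/
theorem CanonicalCoordinates.IsGFunction.pd_zero {C : CanonicalCoordinates M}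
    {G : (Fin n → ℂ) → ℂ} (hG : C.IsGFunction G) (hv : v ∈ M.dom) : pd 0 G v = 0 := by
  -- Since `e = ∑ ∂/∂u_i`, the quadrature is summed over `i`. The factors `u_i - u_j` and `h_i/h_k -
  -- h_k/h_i` are antisymmetric and multiply symmetric functions of `γ`.
  rw [← C.sum_pdu hv G, Finset.sum_congr rfl fun i _ => hG.quadrature v hv i,
    Finset.sum_sub_distrib, ← Finset.mul_sum, ← Finset.mul_sum, sum_sum_erase_eq_zero,
    sum_sum_erase_eq_zero]
  · simp
  · intro i j
    rw [C.rotation_symm hv i j]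
    ring
  · intro i j
    rw [C.rotation_symm hv i j]
    ring

end Semisimple

end GenusTwo

noncomputable section

namespace GenusTwo

/-! ### Derivatives of the two-point functions. -/

section TwoPoint

variable {n : ℕ} [NeZero n] {M : FrobeniusManifold n} {v : Fin n → ℂ}

/-- The trilinear form `⟨∂_γ · ∇f, ∇g⟩`. -/
def FrobeniusManifold.gradTriple (M : FrobeniusManifold n) (γ : Fin n) (f g : (Fin n → ℂ) → ℂ)
    (v : Fin n → ℂ) : ℂ :=
  ∑ κ, ∑ δ, M.η⁻¹ κ δ * (∑ ξ, M.mulCoeff ξ γ κ v * pd ξ f v) * pd δ g v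

/-- With both gradients raised by `η⁻¹` the form is `c_{γκε} X^κ Y^ε`, and the third derivatives of
`F` are symmetric in `κ, ε`. -/
lemma FrobeniusManifold.gradTriple_symm (hv : v ∈ M.dom) (γ : Fin n) (f g : (Fin n → ℂ) → ℂ) :
    M.gradTriple γ f g v = M.gradTriple γ g f v := by
  have key : ∀ f g : (Fin n → ℂ) → ℂ, M.gradTriple γ f g v
      = ∑ κ, ∑ ε, pd γ (pd κ (pd ε M.F)) v *
          ((∑ δ, M.η⁻¹ κ δ * pd δ g v) * ∑ ξ, M.η⁻¹ ε ξ * pd ξ f v) := by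
    intro f g
    unfold gradTriple
    refine Finset.sum_congr rfl fun κ _ => ?_
    have h : ∑ ξ, M.mulCoeff ξ γ κ v * pd ξ f v
        = ∑ ε, pd γ (pd κ (pd ε M.F)) v * ∑ ξ, M.η⁻¹ ε ξ * pd ξ f v := by
      simp only [mulCoeff, Finset.sum_mul, Finset.mul_sum]
      rw [Finset.sum_comm]
      refine Finset.sum_congr rfl fun ε _ => Finset.sum_congr rfl fun ξ _ => ?_
      rw [M.η_inv_symm.apply ε ξ, pd_three_swap_right hv γ κ ε, pd_three_swap_left hv γ ε κ]
      ring
    rw [h, Finset.sum_congr rfl fun δ _ => mul_right_comm _ _ _, ← Finset.sum_mul, Finset.mul_sum]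
    exact Finset.sum_congr rfl fun ε _ => by ring
  rw [key, key, Finset.sum_comm]
  refine Finset.sum_congr rfl fun κ _ => Finset.sum_congr rfl fun ε _ => ?_
  rw [pd_three_swap_right hv γ ε κ]
  ring

lemma FrobeniusManifold.analyticOnNhd_gradPairing {f g : (Fin n → ℂ) → ℂ}
    (hf : AnalyticOnNhd ℂ f M.dom) (hg : AnalyticOnNhd ℂ g M.dom) :
    AnalyticOnNhd ℂ (M.gradPairing f g) M.dom := by
  intro v hv
  unfold gradPairing
  refine Finset.analyticAt_fun_sum _ fun α _ => Finset.analyticAt_fun_sum _ fun β _ => ?_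
  exact (analyticAt_const.fun_mul (analyticOnNhd_pd hf α v hv)).fun_mul (analyticOnNhd_pd hg β v hv)

lemma FrobeniusManifold.pd_gradPairing {f g : (Fin n → ℂ) → ℂ} (hf : AnalyticOnNhd ℂ f M.dom)
    (hg : AnalyticOnNhd ℂ g M.dom) (hv : v ∈ M.dom) (γ : Fin n) :
    pd γ (M.gradPairing f g) v
      = ∑ κ, ∑ δ, M.η⁻¹ κ δ * pd γ (pd κ f) v * pd δ g v
        + ∑ κ, ∑ δ, M.η⁻¹ κ δ * pd γ (pd κ g) v * pd δ f v := by
  have h1 := fun κ => (analyticOnNhd_pd hf κ v hv).differentiableAt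
  have h2 := fun κ => (analyticOnNhd_pd hg κ v hv).differentiableAt
  have h3 : ∑ κ, ∑ δ, M.η⁻¹ κ δ * pd γ (pd κ g) v * pd δ f v
      = ∑ κ, ∑ δ, M.η⁻¹ κ δ * pd κ f v * pd γ (pd δ g) v := by
    rw [Finset.sum_comm]
    refine Finset.sum_congr rfl fun κ _ => Finset.sum_congr rfl fun δ _ => ?_
    rw [M.η_inv_symm.apply κ δ]
    ring
  have h4 := fun κ δ => ((h1 κ).const_mul (M.η⁻¹ κ δ)).fun_mul (h2 δ)
  unfold gradPairing
  rw [h3, pd_sum fun κ _ => DifferentiableAt.fun_sum fun δ _ => h4 κ δ, ← Finset.sum_add_distrib]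
  refine Finset.sum_congr rfl fun κ _ => ?_
  rw [pd_sum fun δ _ => h4 κ δ, ← Finset.sum_add_distrib]
  refine Finset.sum_congr rfl fun δ _ => ?_
  rw [pd_mul ((h1 κ).const_mul _) (h2 δ), pd_const_mul (h1 κ)]

namespace Calibration

variable (Θ : Calibration M)

lemma pd_θ_zero (hv : v ∈ M.dom) (α β : Fin n) : pd β (Θ.θ α 0) v = M.η α β := by
  have hp : ∀ γ, DifferentiableAt ℂ (fun x : Fin n → ℂ => x γ) v := fun γ => by fun_prop
  rw [pd_congr M.isOpen_dom (fun x hx => Θ.θ_zero x hx α) hv,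
    pd_sum fun γ _ => (hp γ).const_mul _]
  have : ∀ γ, pd β (fun x : Fin n → ℂ => x γ) v = if γ = β then 1 else 0 := by
    intro γ
    rw [pd, fderiv_apply differentiableAt_fun_id]
    simp [Pi.single_apply]
  simp [pd_const_mul (hp _), this]

lemma pd_pd_θ_zero (hv : v ∈ M.dom) (α β γ : Fin n) : pd γ (pd β (Θ.θ α 0)) v = 0 := by
  rw [pd_congr M.isOpen_dom (fun x hx => Θ.pd_θ_zero hx α β) hv, pd_const]

lemma analyticOnNhd_twoPoint (a b : Fin n × ℕ) : AnalyticOnNhd ℂ (Θ.twoPoint a b) M.dom := by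
  intro v hv
  unfold twoPoint
  refine Finset.analyticAt_fun_sum _ fun k _ => analyticAt_const.fun_mul ?_
  exact FrobeniusManifold.analyticOnNhd_gradPairing (Θ.analytic_θ _ _) (Θ.analytic_θ _ _) v hv

/-- `∂_γ Ω_{a;b} = ⟨∂_γ · ∇θ_a, ∇θ_b⟩`. -/
lemma pd_twoPoint (hv : v ∈ M.dom) (γ : Fin n) (a b : Fin n × ℕ) :
    pd γ (Θ.twoPoint a b) v = M.gradTriple γ (Θ.θ a.1 a.2) (Θ.θ b.1 b.2) v := by
  obtain ⟨α, p⟩ := a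
  obtain ⟨β, q⟩ := b
  have hΘ := Θ.analytic_θ
  set B : ℕ → ℂ := fun k => (-1) ^ k * M.gradTriple γ (Θ.θ α (p + k)) (Θ.θ β (q - k)) v with hB
  have hstep : ∀ (α : Fin n) (p : ℕ) (g : (Fin n → ℂ) → ℂ),
      ∑ κ, ∑ δ, M.η⁻¹ κ δ * pd γ (pd κ (Θ.θ α (p + 1))) v * pd δ g v
        = M.gradTriple γ (Θ.θ α p) g v := by
    intro α p g
    simp only [FrobeniusManifold.gradTriple, Θ.flatness v hv]
  have hsum : pd γ (Θ.twoPoint (α, p) (β, q)) v = ∑ k ∈ Finset.range (q + 1), (B k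
      + (-1) ^ k * ∑ κ, ∑ δ, M.η⁻¹ κ δ * pd γ (pd κ (Θ.θ β (q - k))) v *
          pd δ (Θ.θ α (p + 1 + k)) v) := by
    have hd := fun k => (FrobeniusManifold.analyticOnNhd_gradPairing (M := M)
      (hΘ α (p + 1 + k)) (hΘ β (q - k)) v hv).differentiableAt
    unfold twoPoint
    rw [pd_sum fun k _ => (hd k).const_mul _]
    refine Finset.sum_congr rfl fun k _ => ?_
    rw [pd_const_mul (hd k), FrobeniusManifold.pd_gradPairing (hΘ _ _) (hΘ _ _) hv, mul_add,
      show p + 1 + k = p + k + 1 by ring, hstep]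
  -- The sum telescopes: by flatness, differentiating the second gradient gives `-B (k + 1)`, and at
  -- `k = q` it gives zero because `θ_{β,0}` has constant gradient. Only `B 0` survives.
  have htail : ∑ k ∈ Finset.range (q + 1), (-1 : ℂ) ^ k * ∑ κ, ∑ δ, M.η⁻¹ κ δ *
      pd γ (pd κ (Θ.θ β (q - k))) v * pd δ (Θ.θ α (p + 1 + k)) v
      = -∑ k ∈ Finset.range q, B (k + 1) := by
    rw [Finset.sum_range_succ, ← Finset.sum_neg_distrib]
    simp only [Nat.sub_self, Θ.pd_pd_θ_zero hv, mul_zero, zero_mul, Finset.sum_const_zero, add_zero]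
    refine Finset.sum_congr rfl fun k hk => ?_
    have hk := Finset.mem_range.1 hk
    rw [show q - k = q - (k + 1) + 1 by omega, hstep, FrobeniusManifold.gradTriple_symm hv, hB]
    simp only [pow_succ, show p + 1 + k = p + (k + 1) by ring]
    ring
  rw [hsum, Finset.sum_add_distrib, htail, Finset.sum_range_succ']
  simp [hB]

lemma twoPoint_zero_zero (hv : v ∈ M.dom) (α β : Fin n) :
    Θ.twoPoint (α, 0) (β, 0) v = pd α (pd β M.F) v := by
  have h : M.η⁻¹ * M.η = 1 := Matrix.nonsing_inv_mul _ M.η_nondeg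
  have h1 : ∀ κ, ∑ δ, M.η⁻¹ κ δ * M.η β δ = if κ = β then 1 else 0 := by
    intro κ
    rw [← Matrix.one_apply, ← h, Matrix.mul_apply]
    exact Finset.sum_congr rfl fun δ _ => by rw [M.η_symm.apply β δ]
  have h2 : ∀ κ, pd κ (Θ.θ α 1) v = pd κ (pd α M.F) v := fun κ =>
    pd_congr M.isOpen_dom (fun x hx => Θ.θ_one x hx α) hv κ
  rw [pd_comm M.analytic_F hv, ← h2]
  simp only [twoPoint, FrobeniusManifold.gradPairing, zero_add, Finset.sum_range_one, pow_zero,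
    one_mul, add_zero, Nat.sub_zero, Θ.pd_θ_zero hv]
  have h3 : ∀ κ, ∑ δ, M.η⁻¹ κ δ * pd κ (Θ.θ α 1) v * M.η β δ
      = (if κ = β then 1 else 0) * pd κ (Θ.θ α 1) v := by
    intro κ
    rw [← h1, Finset.sum_mul]
    exact Finset.sum_congr rfl fun δ _ => mul_right_comm _ _ _
  simp [h3]

end Calibration

end TwoPoint

/-! ### Differentiation along the small phase space. -/

section SmallPhase

variable {n : ℕ}

/-- The inclusion of the small phase space into the big one. -/
def smallEmb (w : Fin n → ℂ) : BigPhase n := truncated 1 fun a => w a.1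

lemma smallEmb_apply (w : Fin n → ℂ) (α : Fin n) (p : ℕ) :
    smallEmb w (α, p) = if p = 0 then w α else 0 := by
  classical
  simp only [smallEmb, truncated, Finsupp.finsetSum_apply, Finsupp.single_apply, Prod.mk.injEq,
    Fintype.sum_prod_type]
  by_cases hp : p = 0
  · simp [hp]
  · simp [hp, Ne.symm hp]

lemma smallEmb_of_mem {t : BigPhase n} (ht : t ∈ smallPhase n) :
    smallEmb (fun α => t (α, 0)) = t := by
  ext ⟨α, p⟩
  rw [smallEmb_apply]
  split_ifs with h
  · rw [h]
  · exact (ht α p (Nat.pos_of_ne_zero h)).symm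

lemma smallEmb_add_smul_single (w : Fin n → ℂ) (s : ℂ) (α : Fin n) :
    smallEmb (w + s • Pi.single α 1) = smallEmb w + s • Finsupp.single (α, 0) 1 := by
  classical
  ext ⟨β, p⟩
  by_cases hp : p = 0 <;>
  simp [smallEmb_apply, hp, Finsupp.single_apply, Pi.single_apply, eq_comm]

/-- The line through a small point in the direction `t^{α,0}` stays in the small phase space, so
only the restriction of `f` matters and no regularity in the higher times is needed. -/
lemma pt_smallEmb (f : BigPhase n → ℂ) {U : Set (Fin n → ℂ)} (hU : IsOpen U)
    {g : (Fin n → ℂ) → ℂ} (hg : AnalyticOnNhd ℂ g U) (h : ∀ w ∈ U, f (smallEmb w) = g w)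
    {w : Fin n → ℂ} (hw : w ∈ U) (α : Fin n) : pt α f (smallEmb w) = pd α g w := by
  unfold pt pd
  rw [← (hg w hw).differentiableAt.lineDeriv_eq_fderiv]
  unfold lineDeriv
  simp only [← smallEmb_add_smul_single]
  refine Filter.EventuallyEq.deriv_eq ?_
  have hc : ContinuousAt (fun s : ℂ => w + s • (Pi.single α 1 : Fin n → ℂ)) 0 := by fun_prop
  filter_upwards [hc.preimage_mem_nhds (by simpa using hU.mem_nhds hw)] with s hs
  exact h _ hs

lemma ptList_append (l l' : List (Fin n)) (f : BigPhase n → ℂ) :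
    ptList (l ++ l') f = ptList l (ptList l' f) := by
  induction l with
  | nil => rfl
  | cons α l ih => simp [ptList, ih]

/-- The alternative `c = 0` admits the empty list. -/
lemma ptList_smallEmb_of_const {f : BigPhase n → ℂ} {U : Set (Fin n → ℂ)} (hU : IsOpen U) {c : ℂ}
    (h : ∀ w ∈ U, f (smallEmb w) = c) {l : List (Fin n)} (hl : l ≠ [] ∨ c = 0) :
    ∀ w ∈ U, ptList l f (smallEmb w) = 0 := by
  induction l with
  | nil => intro w hw; rw [ptList, h w hw]; simpa using hl
  | cons α l ih =>
    intro w hw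
    by_cases hl' : l = []
    · subst hl'
      rw [ptList, ptList, pt_smallEmb f hU (g := fun _ => c) analyticOnNhd_const h hw, pd_const]
    · rw [ptList, pt_smallEmb _ hU (g := fun _ => 0) analyticOnNhd_const (ih (.inl hl')) hw,
        pd_const]

end SmallPhase

/-! ### The topological solution at small times. -/

namespace TopologicalSolution

variable {n : ℕ} [NeZero n] {M : FrobeniusManifold n} {Θ : Calibration M}
  (S : TopologicalSolution Θ)

/-- The part of the domain of `v(t)` in the small phase space. -/
def smallDom : Set (Fin n → ℂ) := {w | smallEmb w ∈ S.dom}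

lemma isOpen_smallDom : IsOpen S.smallDom :=
  (S.isOpen_dom 1).preimage (f := fun (w : Fin n → ℂ) (a : Fin n × Fin 1) => w a.1) (by fun_prop)

/-- The restriction of `v(t)` to the small phase space. -/
def smallV (w : Fin n → ℂ) : Fin n → ℂ := S.v (smallEmb w)

variable {S} {w : Fin n → ℂ}

lemma smallV_mem (hw : w ∈ S.smallDom) : S.smallV w ∈ M.dom := S.mapsTo _ hw

variable (S) in
lemma analyticOnNhd_smallV : AnalyticOnNhd ℂ S.smallV S.smallDom := by
  intro w hw
  have h := S.analytic_v 1 (fun a => w a.1) hw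
  exact h.fun_comp (f := fun (w : Fin n → ℂ) (a : Fin n × Fin 1) => w a.1)
    ((ContinuousLinearMap.pi fun a : Fin n × Fin 1 =>
      ContinuousLinearMap.proj (R := ℂ) (φ := fun _ : Fin n => ℂ) a.1).analyticAt w)

/-- The shifted times of a point in the small phase space are supported in `p ≤ 1`. -/
lemma dilatonShift_sum (f : Fin n × ℕ → ℂ → ℂ) (hf : ∀ a, f a 0 = 0) :
    (dilatonShift (smallEmb w)).sum f
      = ∑ a ∈ Finset.univ ×ˢ Finset.range 2, f a (dilatonShift (smallEmb w) a) := by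
  classical
  refine Finsupp.sum_of_support_subset _ (fun a ha => ?_) _ fun a _ => hf a
  obtain ⟨α, p⟩ := a
  by_contra hp
  simp only [Finset.mem_product, Finset.mem_univ, Finset.mem_range, true_and, not_lt] at hp
  refine Finsupp.mem_support_iff.1 ha ?_
  simp [dilatonShift, smallEmb_apply, show p ≠ 0 by omega,
    show ¬ (1 = p) by omega]

lemma dilatonShift_smallEmb (a : Fin n × ℕ) : dilatonShift (smallEmb w) a
    = (if a.2 = 0 then w a.1 else 0) - Finsupp.single ((0 : Fin n), 1) (1 : ℂ) a := by
  rw [dilatonShift, Finsupp.sub_apply, ← smallEmb_apply]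

lemma analyticAt_dilatonShift (a : Fin n × ℕ) :
    AnalyticAt ℂ (fun w : Fin n → ℂ => dilatonShift (smallEmb w) a) w := by
  simp only [dilatonShift_smallEmb]
  refine AnalyticAt.fun_sub ?_ analyticAt_const
  split_ifs
  · exact (ContinuousLinearMap.proj (R := ℂ) (φ := fun _ : Fin n => ℂ) a.1).analyticAt w
  · exact analyticAt_const

lemma pd_dilatonShift (a : Fin n × ℕ) (α : Fin n) :
    pd α (fun w : Fin n → ℂ => dilatonShift (smallEmb w) a) w = if a = (α, 0) then 1 else 0 := by
  obtain ⟨β, p⟩ := a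
  simp only [dilatonShift_smallEmb]
  unfold pd
  rw [fderiv_sub_const]
  by_cases hp : p = 0
  · simp only [hp, if_true]
    rw [fderiv_apply differentiableAt_fun_id]
    simp [Pi.single_apply]
  · simp [hp]

end TopologicalSolution

end GenusTwo

end

noncomputable section

namespace GenusTwo

namespace TopologicalSolution

variable {n : ℕ} [NeZero n] {M : FrobeniusManifold n} {Θ : Calibration M}
  {S : TopologicalSolution Θ} {w : Fin n → ℂ}

lemma eulerLagrange_small (hw : w ∈ S.smallDom) (γ : Fin n) :
    ∑ a ∈ Finset.univ ×ˢ Finset.range 2,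
      dilatonShift (smallEmb w) a * pd γ (Θ.θ a.1 a.2) (S.smallV w) = 0 := by
  exact (dilatonShift_sum (fun a c => c * pd γ (Θ.θ a.1 a.2) (S.smallV w))
    fun _ => zero_mul _).symm.trans (S.eulerLagrange _ hw γ)

lemma pd_comp_smallV {g : (Fin n → ℂ) → ℂ} (hg : AnalyticOnNhd ℂ g M.dom) (hw : w ∈ S.smallDom)
    (α : Fin n) : pd α (fun x => g (S.smallV x)) w
      = ∑ δ, pd α (fun x => S.smallV x δ) w * pd δ g (S.smallV w) :=
  pd_comp (hg _ (smallV_mem hw)).differentiableAt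
    (S.analyticOnNhd_smallV w hw).differentiableAt α

lemma analyticOnNhd_comp_smallV {g : (Fin n → ℂ) → ℂ} (hg : AnalyticOnNhd ℂ g M.dom) :
    AnalyticOnNhd ℂ (fun x => g (S.smallV x)) S.smallDom :=
  fun w hw => (hg _ (smallV_mem hw)).fun_comp (S.analyticOnNhd_smallV w hw)

/-- On the small phase space `∂v^δ/∂t^α = δ^δ_α`. -/
lemma pd_smallV (hw : w ∈ S.smallDom) (α δ : Fin n) :
    pd α (fun x => S.smallV x δ) w = if δ = α then 1 else 0 := by
  -- The `t^{α,0}`-derivative of the Euler–Lagrange equation: the left side comes from `t̃^{α,0}`,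
  -- the right side from `t̃^{0,1} = -1`.
  have hη : ∀ γ, M.η α γ = ∑ δ, pd α (fun x => S.smallV x δ) w * M.η δ γ := by
    intro γ
    have hθ : ∀ β p, AnalyticOnNhd ℂ (pd γ (Θ.θ β p)) M.dom := fun β p =>
      analyticOnNhd_pd (Θ.analytic_θ β p) γ
    have h0 : pd α (fun x => ∑ a ∈ Finset.univ ×ˢ Finset.range 2,
        dilatonShift (smallEmb x) a * pd γ (Θ.θ a.1 a.2) (S.smallV x)) w = 0 := by
      rw [pd_congr S.isOpen_smallDom (fun x hx => eulerLagrange_small hx γ) hw, pd_const]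
    have hd := fun a : Fin n × ℕ => (analyticAt_dilatonShift (w := w) a).differentiableAt
    have hc := fun a : Fin n × ℕ =>
      (analyticOnNhd_comp_smallV (S := S) (hθ a.1 a.2) w hw).differentiableAt
    rw [pd_sum fun a _ => (hd a).fun_mul (hc a)] at h0
    simp only [pd_mul (hd _) (hc _), pd_dilatonShift, Finset.sum_add_distrib, ite_mul, one_mul,
      zero_mul, Finset.sum_ite_eq', Finset.mem_product, Finset.mem_univ, Finset.mem_range,
      Nat.zero_lt_two, and_self, if_true, Θ.pd_θ_zero (smallV_mem hw)] at h0
    -- Terms with `p = 0` drop out since `∇θ_{β,0}` is constant; among those with `p = 1` only `β =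
    -- 0` has a nonzero shifted time.
    have h1 : ∀ a : Fin n × ℕ, a ∈ Finset.univ ×ˢ Finset.range 2 →
        dilatonShift (smallEmb w) a * pd α (fun x => pd γ (Θ.θ a.1 a.2) (S.smallV x)) w
          = if a = (0, 1) then -∑ δ, pd α (fun x => S.smallV x δ) w * M.η δ γ else 0 := by
      rintro ⟨β, p⟩ ha
      have hp : p < 2 := by simpa using ha
      rw [pd_comp_smallV (hθ β p) hw]
      interval_cases p
      · simp [Θ.pd_pd_θ_zero (smallV_mem hw)]
      · have h2 : ∀ δ, pd δ (pd γ (Θ.θ 0 1)) (S.smallV w) = M.η δ γ := by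
          intro δ
          rw [pd_congr M.isOpen_dom (g := pd γ (pd 0 M.F))
            (fun x hx => pd_congr M.isOpen_dom (fun y hy => Θ.θ_one y hy 0) hx γ) (smallV_mem hw),
            FrobeniusManifold.unit_right (smallV_mem hw)]
        by_cases hβ : β = 0
        · subst hβ
          simp [dilatonShift_smallEmb, h2]
        · simp [dilatonShift_smallEmb, hβ]
    rw [Finset.sum_congr rfl h1] at h0
    simp only [Finset.sum_ite_eq', Finset.mem_product, Finset.mem_univ, Finset.mem_range,
      Nat.one_lt_two, and_self, if_true] at h0
    exact eq_of_sub_eq_zero (by rw [sub_eq_add_neg]; exact h0)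
  have h : M.η * M.η⁻¹ = 1 := Matrix.mul_nonsing_inv _ M.η_nondeg
  have hvec : (fun δ => pd α (fun x => S.smallV x δ) w) = Pi.single α 1 := by
    have h1 : Matrix.vecMul (fun δ => pd α (fun x => S.smallV x δ) w) M.η
        = Matrix.vecMul (Pi.single α 1) M.η := by
      funext γ
      rw [Matrix.single_one_vecMul]
      exact (hη γ).symm
    have h2 := congrArg (fun x => Matrix.vecMul x M.η⁻¹) h1
    simpa only [Matrix.vecMul_vecMul, h, Matrix.vecMul_one] using h2
  rw [congrFun hvec δ, Pi.single_apply]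

/-- The Jacobian of `smallV` is the identity; the value of `v`, determined only up to a local
translation by this, is never needed. -/
lemma pd_comp_smallV_eq {g : (Fin n → ℂ) → ℂ} (hg : AnalyticOnNhd ℂ g M.dom)
    (hw : w ∈ S.smallDom) (α : Fin n) :
    pd α (fun x => g (S.smallV x)) w = pd α g (S.smallV w) := by
  simp [pd_comp_smallV hg hw, pd_smallV hw]

/-! ### Genus zero -/

lemma freeEnergyZero_small (w : Fin n → ℂ) : S.freeEnergyZero (smallEmb w)
    = 1 / 2 * ∑ a ∈ Finset.univ ×ˢ Finset.range 2, ∑ b ∈ Finset.univ ×ˢ Finset.range 2,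
        dilatonShift (smallEmb w) a * dilatonShift (smallEmb w) b
          * Θ.twoPoint a b (S.smallV w) := by
  rw [freeEnergyZero, dilatonShift_sum _ fun a => ?_]
  · refine congrArg _ (Finset.sum_congr rfl fun a _ => ?_)
    rw [dilatonShift_sum _ fun b => by ring]
    rfl
  · simp [Finsupp.sum]

/-- `∑_b t̃^b ∂_γ Ω_{a;b} = 0` along the topological solution. -/
lemma sum_dilatonShift_pd_twoPoint (hw : w ∈ S.smallDom) (γ : Fin n) (a : Fin n × ℕ) :
    ∑ b ∈ Finset.univ ×ˢ Finset.range 2,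
      dilatonShift (smallEmb w) b * pd γ (Θ.twoPoint a b) (S.smallV w) = 0 := by
  simp only [Θ.pd_twoPoint (smallV_mem hw), FrobeniusManifold.gradTriple, Finset.mul_sum]
  rw [Finset.sum_comm]
  refine Finset.sum_eq_zero fun κ _ => ?_
  rw [Finset.sum_comm]
  refine Finset.sum_eq_zero fun δ _ => ?_
  -- The sum over `b` meets only the second gradient in `⟨∂_γ · ∇θ_a, ∇θ_b⟩`.
  have h := eulerLagrange_small hw δ
  rw [← mul_zero (M.η⁻¹ κ δ * ∑ ξ, M.mulCoeff ξ γ κ (S.smallV w) * pd ξ (Θ.θ a.1 a.2) (S.smallV w)),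
    ← h]
  simp only [Finset.mul_sum, Finset.sum_mul]
  exact Finset.sum_congr rfl fun b _ => Finset.sum_congr rfl fun ξ _ => by ring

lemma pd_twoPoint_swap (hw : w ∈ S.smallDom) (γ : Fin n) (a b : Fin n × ℕ) :
    pd γ (Θ.twoPoint a b) (S.smallV w) = pd γ (Θ.twoPoint b a) (S.smallV w) := by
  rw [Θ.pd_twoPoint (smallV_mem hw), Θ.pd_twoPoint (smallV_mem hw),
    FrobeniusManifold.gradTriple_symm (smallV_mem hw)]

lemma analyticAt_twoPoint_small (hw : w ∈ S.smallDom) (a b : Fin n × ℕ) :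
    AnalyticAt ℂ (fun x => Θ.twoPoint a b (S.smallV x)) w :=
  analyticOnNhd_comp_smallV (Θ.analyticOnNhd_twoPoint a b) w hw

/-- The function `½ ∑_b (Ω_{α,0;b} + Ω_{b;α,0}) t̃^b`, which is `∂𝓕₀/∂t^{α,0}`. -/
def onePointZero (S : TopologicalSolution Θ) (α : Fin n) (w : Fin n → ℂ) : ℂ :=
  1 / 2 * ∑ b ∈ Finset.univ ×ˢ Finset.range 2, dilatonShift (smallEmb w) b *
    (Θ.twoPoint (α, 0) b (S.smallV w) + Θ.twoPoint b (α, 0) (S.smallV w))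

lemma analyticOnNhd_onePointZero (α : Fin n) :
    AnalyticOnNhd ℂ (S.onePointZero α) S.smallDom := fun _ hw =>
  analyticAt_const.fun_mul (Finset.analyticAt_fun_sum _ fun b _ => (analyticAt_dilatonShift b).fun_mul
    ((analyticAt_twoPoint_small hw _ b).fun_add (analyticAt_twoPoint_small hw b _)))

lemma analyticOnNhd_freeEnergyZero_small :
    AnalyticOnNhd ℂ (fun w => S.freeEnergyZero (smallEmb w)) S.smallDom := by
  intro w hw
  simp only [freeEnergyZero_small]
  exact analyticAt_const.fun_mul (Finset.analyticAt_fun_sum _ fun a _ =>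
    Finset.analyticAt_fun_sum _ fun b _ => ((analyticAt_dilatonShift a).fun_mul
      (analyticAt_dilatonShift b)).fun_mul (analyticAt_twoPoint_small hw a b))

/-- Leibniz on the quadratic form: the two times give the two halves of `onePointZero`, while the
derivative of `Ω` sums to zero by the Euler–Lagrange equation. -/
lemma pd_freeEnergyZero_small (hw : w ∈ S.smallDom) (α : Fin n) :
    pd α (fun w => S.freeEnergyZero (smallEmb w)) w = S.onePointZero α w := by
  set T : Finset (Fin n × ℕ) := Finset.univ ×ˢ Finset.range 2 with hT
  have hαT : (α, 0) ∈ T := by simp [hT]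
  have ht := fun a : Fin n × ℕ => (analyticAt_dilatonShift (w := w) a).differentiableAt
  have hΩ := fun a b : Fin n × ℕ => (analyticAt_twoPoint_small hw a b).differentiableAt
  have hab := fun a b => ((ht a).fun_mul (ht b)).fun_mul (hΩ a b)
  have hs := fun a => DifferentiableAt.fun_sum fun b (_ : b ∈ T) => hab a b
  have hterm : ∀ a b, pd α (fun w => dilatonShift (smallEmb w) a * dilatonShift (smallEmb w) b
        * Θ.twoPoint a b (S.smallV w)) w
      = (if a = (α, 0) then dilatonShift (smallEmb w) b * Θ.twoPoint a b (S.smallV w) else 0)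
        + (if b = (α, 0) then dilatonShift (smallEmb w) a * Θ.twoPoint a b (S.smallV w) else 0)
        + dilatonShift (smallEmb w) a *
          (dilatonShift (smallEmb w) b * pd α (Θ.twoPoint a b) (S.smallV w)) := by
    intro a b
    rw [pd_mul ((ht a).fun_mul (ht b)) (hΩ a b), pd_mul (ht a) (ht b), pd_dilatonShift,
      pd_dilatonShift, pd_comp_smallV_eq (Θ.analyticOnNhd_twoPoint a b) hw]
    split_ifs <;> ring
  simp only [freeEnergyZero_small]
  rw [pd_const_mul (DifferentiableAt.fun_sum fun a _ => hs a), pd_sum fun a _ => hs a, onePointZero]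
  congr 1
  rw [Finset.sum_congr rfl fun a _ => pd_sum (fun b _ => hab a b) α]
  simp only [hterm, Finset.sum_add_distrib, ← Finset.mul_sum, hT, sum_dilatonShift_pd_twoPoint hw,
    mul_zero, add_zero]
  rw [← hT, Finset.sum_comm]
  simp only [Finset.sum_ite_eq', hαT, if_true, mul_add, Finset.sum_add_distrib]

/-- The two orderings of `Ω` have the same derivative, so symmetry of `Ω` itself is not required.
These derivatives again sum to zero, leaving `Ω_{β,0;α,0}` symmetrised. -/
lemma pd_onePointZero (hw : w ∈ S.smallDom) (α β : Fin n) :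
    pd α (S.onePointZero β) w = pd α (pd β M.F) (S.smallV w) := by
  set T : Finset (Fin n × ℕ) := Finset.univ ×ˢ Finset.range 2 with hT
  have hαT : (α, 0) ∈ T := by simp [hT]
  have ht := fun a : Fin n × ℕ => (analyticAt_dilatonShift (w := w) a).differentiableAt
  have hΩ := fun a b : Fin n × ℕ => (analyticAt_twoPoint_small hw a b).differentiableAt
  have hab := fun b => (ht b).fun_mul ((hΩ (β, 0) b).fun_add (hΩ b (β, 0)))
  have hterm : ∀ b, pd α (fun w => dilatonShift (smallEmb w) b *
        (Θ.twoPoint (β, 0) b (S.smallV w) + Θ.twoPoint b (β, 0) (S.smallV w))) w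
      = (if b = (α, 0) then
          Θ.twoPoint (β, 0) b (S.smallV w) + Θ.twoPoint b (β, 0) (S.smallV w) else 0)
        + 2 * (dilatonShift (smallEmb w) b * pd α (Θ.twoPoint (β, 0) b) (S.smallV w)) := by
    intro b
    rw [pd_mul (ht b) ((hΩ _ _).fun_add (hΩ _ _)), pd_add (hΩ _ _) (hΩ _ _), pd_dilatonShift,
      pd_comp_smallV_eq (Θ.analyticOnNhd_twoPoint _ _) hw,
      pd_comp_smallV_eq (Θ.analyticOnNhd_twoPoint _ _) hw, pd_twoPoint_swap hw α b]
    split_ifs <;> ring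
  unfold onePointZero
  rw [pd_const_mul (DifferentiableAt.fun_sum fun b _ => hab b), pd_sum fun b _ => hab b,
    Finset.sum_congr rfl fun b _ => hterm b, Finset.sum_add_distrib, ← Finset.mul_sum,
    sum_dilatonShift_pd_twoPoint hw, Finset.sum_ite_eq', if_pos hαT,
    Θ.twoPoint_zero_zero (smallV_mem hw), Θ.twoPoint_zero_zero (smallV_mem hw),
    pd_comm M.analytic_F (smallV_mem hw) β α]
  ring

lemma ptList_two_freeEnergyZero (hw : w ∈ S.smallDom) (α β : Fin n) :
    ptList [α, β] S.freeEnergyZero (smallEmb w) = pd α (pd β M.F) (S.smallV w) := by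
  have h1 : ∀ w ∈ S.smallDom, pt β S.freeEnergyZero (smallEmb w) = S.onePointZero β w :=
    fun w hw => (pt_smallEmb _ S.isOpen_smallDom analyticOnNhd_freeEnergyZero_small
      (fun _ _ => rfl) hw β).trans (pd_freeEnergyZero_small hw β)
  exact (pt_smallEmb _ S.isOpen_smallDom (analyticOnNhd_onePointZero β) h1 hw α).trans
    (pd_onePointZero hw α β)

lemma ptList_three_freeEnergyZero (hw : w ∈ S.smallDom) (α β γ : Fin n) :
    ptList [α, β, γ] S.freeEnergyZero (smallEmb w)
      = pd α (pd β (pd γ M.F)) (S.smallV w) := by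
  have hF : AnalyticOnNhd ℂ (pd β (pd γ M.F)) M.dom :=
    analyticOnNhd_pd (analyticOnNhd_pd M.analytic_F γ) β
  exact (pt_smallEmb _ S.isOpen_smallDom (analyticOnNhd_comp_smallV hF)
    (fun w hw => ptList_two_freeEnergyZero hw β γ) hw α).trans (pd_comp_smallV_eq hF hw α)

/-- Genus zero correlators with at least four entries, one of which is the unit, vanish on the
small phase space. -/
lemma ptList_freeEnergyZero_eq_zero (hw : w ∈ S.smallDom) {l : List (Fin n)} (hl : 3 ≤ l.length) :
    ptList (l ++ [0]) S.freeEnergyZero (smallEmb w) = 0 := by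
  -- The last entries of a list act first: `α, β, 0` already produce the constant `η_{αβ}`, and the
  -- nonempty `l'` then differentiates it.
  obtain ⟨l', α, β, hl', rfl⟩ : ∃ l' α β, l' ≠ [] ∧ l = l' ++ [α, β] := by
    obtain ⟨l₁, β, rfl⟩ := List.eq_nil_or_concat' l |>.resolve_left (by rintro rfl; simp at hl)
    obtain ⟨l₂, α, rfl⟩ := List.eq_nil_or_concat' l₁ |>.resolve_left (by rintro rfl; simp at hl)
    exact ⟨l₂, α, β, by rintro rfl; simp at hl, by simp⟩
  rw [List.append_assoc, ptList_append]
  refine ptList_smallEmb_of_const S.isOpen_smallDom (c := M.η α β) (fun w hw => ?_) (.inl hl') w hw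
  exact (ptList_three_freeEnergyZero hw α β 0).trans
    (FrobeniusManifold.unit_right (smallV_mem hw) α β)

/-! ### Jets and genus one -/

lemma jetV_one_small (hw : w ∈ S.smallDom) (α : Fin n) :
    S.jetV 1 (smallEmb w) α = if α = 0 then 1 else 0 :=
  (pt_smallEmb _ S.isOpen_smallDom (g := fun x => S.smallV x α)
    (fun x hx => analyticAt_pi_iff.1 (S.analyticOnNhd_smallV x hx) α) (fun _ _ => rfl) hw 0).trans
    (pd_smallV hw 0 α)

lemma jetV_small_of_two_le (hw : w ∈ S.smallDom) {k : ℕ} (hk : 2 ≤ k) (α : Fin n) :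
    S.jetV k (smallEmb w) α = 0 := by
  obtain ⟨k, rfl⟩ := Nat.exists_eq_add_of_le' hk
  rw [jetV, show k + 2 = k + 1 + 1 from rfl, List.replicate_succ', ptList_append]
  exact ptList_smallEmb_of_const S.isOpen_smallDom (fun x hx => jetV_one_small hx α)
    (.inl (by simp)) w hw

variable (C : CanonicalCoordinates M)

lemma jetU_one_small (hw : w ∈ S.smallDom) (i : Fin n) : S.jetU C 1 (smallEmb w) i = 1 := by
  have hu := C.analyticOnNhd_u i
  exact (pt_smallEmb _ S.isOpen_smallDom (analyticOnNhd_comp_smallV hu) (fun _ _ => rfl) hw 0).trans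
    ((pd_comp_smallV_eq hu hw 0).trans (C.pd_zero_u (smallV_mem hw) i))

lemma jetU_two_small (hw : w ∈ S.smallDom) (i : Fin n) : S.jetU C 2 (smallEmb w) i = 0 :=
  ptList_smallEmb_of_const (l := [0]) S.isOpen_smallDom (fun _ hx => jetU_one_small C hx i)
    (.inl (by simp)) w hw

variable {C} {G : (Fin n → ℂ) → ℂ}

/-- Genus one correlators containing the unit vanish on the small phase space. -/
lemma ptList_freeEnergyOne_eq_zero (hG : C.IsGFunction G) (hw : w ∈ S.smallDom)
    (l : List (Fin n)) : ptList (l ++ [0]) (S.freeEnergyOne C G) (smallEmb w) = 0 := by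
  rw [ptList_append]
  refine ptList_smallEmb_of_const S.isOpen_smallDom (c := 0) (fun w hw => ?_) (.inr rfl) w hw
  refine (pt_smallEmb _ S.isOpen_smallDom (analyticOnNhd_comp_smallV hG.analytic)
    (fun w hw => ?_) hw 0).trans
    ((pd_comp_smallV_eq hG.analytic hw 0).trans (hG.pd_zero (smallV_mem hw)))
  -- `log u_{i,x} = log 1 = 0`, so `𝓕₁` restricts to `G(v)`.
  simp [ptList, freeEnergyOne, jetU_one_small C hw, smallV]

end TopologicalSolution

/-! ### The sixteen graphs -/

/-- The number of half-edges at a vertex. -/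
def DualGraph.numHalfEdges (Γ : DualGraph) (w : Fin Γ.numVertices) : ℕ :=
  (Γ.edges.map fun e => (if e.1 = w then 1 else 0) + if e.2 = w then 1 else 0).sum

/-- The valence does not depend on the indices carried by the edges, which makes the vertex
condition a decidable property of the graph. -/
lemma DualGraph.length_halfEdgeIndices (Γ : DualGraph) {n : ℕ}
    (idx : Fin Γ.edges.length → Fin n × Fin n) (w : Fin Γ.numVertices) :
    (Γ.halfEdgeIndices idx w).length = Γ.numHalfEdges w := by
  have h : Γ.edges = (List.finRange Γ.edges.length).map Γ.edges.get := by simp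
  rw [halfEdgeIndices, numHalfEdges, List.length_flatMap]
  conv_rhs => rw [h, List.map_map]
  congr 1
  refine List.map_congr_left fun j _ => ?_
  simp only [List.length_append, Function.comp_apply, apply_ite List.length, List.length_cons,
    List.length_nil]

variable {n : ℕ} [NeZero n] {M : FrobeniusManifold n} {Θ : Calibration M}
  {S : TopologicalSolution Θ} {C : CanonicalCoordinates M} {G : (Fin n → ℂ) → ℂ}

/-- A graph having a vertex with a leg which is of positive genus or of valence at least four does
not contribute on the small phase space. -/
lemma DualGraph.contribution_smallEmb (Γ : DualGraph) (hG : C.IsGFunction G) {w : Fin n → ℂ}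
    (hw : w ∈ S.smallDom) (a : Fin Γ.numVertices) (hleg : 1 ≤ Γ.legs a)
    (ha : Γ.genus a ≠ 0 ∨ 4 ≤ Γ.numHalfEdges a + Γ.legs a) :
    Γ.contribution S C G (smallEmb w) = 0 := by
  refine Finset.sum_eq_zero fun idx _ => mul_eq_zero_of_right _ ?_
  refine Finset.prod_eq_zero (Finset.mem_univ a) ?_
  obtain ⟨k, hk⟩ := Nat.exists_eq_add_of_le' hleg
  -- One leg is split off at the end of the list, where it acts first; valence at least four leaves
  -- at least three other entries.
  rw [hk, List.replicate_succ', ← List.append_assoc]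
  split_ifs with h
  · refine TopologicalSolution.ptList_freeEnergyZero_eq_zero hw ?_
    have := ha.resolve_left (not_not.2 h)
    rw [List.length_append, Γ.length_halfEdgeIndices, List.length_replicate]
    omega
  · exact TopologicalSolution.ptList_freeEnergyOne_eq_zero hG hw _

lemma sixteenGraphs_exists_vertex (p : Fin 16) : ∃ a, 1 ≤ (sixteenGraphs p).legs a ∧
    ((sixteenGraphs p).genus a ≠ 0 ∨
      4 ≤ (sixteenGraphs p).numHalfEdges a + (sixteenGraphs p).legs a) := by
  revert p
  decide

lemma termQ_smallEmb (hG : C.IsGFunction G) {w : Fin n → ℂ} (hw : w ∈ S.smallDom) (p : Fin 16) :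
    termQ S C G p (smallEmb w) = 0 := by
  obtain ⟨a, hleg, ha⟩ := sixteenGraphs_exists_vertex p
  exact (sixteenGraphs p).contribution_smallEmb hG hw a hleg ha

end GenusTwo

end

/-- Restriction to the small phase space: the jets of the topological solution become
`v_x = e` and `v^{(k)} = 0` for `k ≥ 2`; `∂_e G = 0`; the sixteen terms `Q_p` vanish; and hence only
the term `G₂(u, u_x, u_xx)` of the genus two decomposition survives, at `u_x = 1`, `u_xx = 0`. -/
theorem mainTheorem3 {n : ℕ} [NeZero n] (M : GenusTwo.FrobeniusManifold n)
    (C : GenusTwo.CanonicalCoordinates M) (Θ : GenusTwo.Calibration M)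
    (S : GenusTwo.TopologicalSolution Θ) (G : (Fin n → ℂ) → ℂ) (hG : C.IsGFunction G) :
    (∀ w ∈ M.dom, GenusTwo.pd 0 G w = 0) ∧
    ∀ t ∈ S.dom, t ∈ GenusTwo.smallPhase n →
      (∀ α, S.jetV 1 t α = if α = 0 then 1 else 0) ∧
      (∀ k, 2 ≤ k → ∀ α, S.jetV k t α = 0) ∧
      (∀ p : Fin 16, GenusTwo.termQ S C G p t = 0) ∧
      (∀ G₂ : (Fin n → ℂ) → (Fin n → ℂ) → (Fin n → ℂ) → ℂ,
        GenusTwo.genusTwoDecomposition S C G G₂ t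
          = G₂ (C.u (S.v t)) (fun _ => 1) (fun _ => 0)) := by
  refine ⟨fun w hw => hG.pd_zero hw, fun t ht hts => ?_⟩
  obtain ⟨w, rfl⟩ : ∃ w, GenusTwo.smallEmb w = t := ⟨_, GenusTwo.smallEmb_of_mem hts⟩
  have hw : w ∈ S.smallDom := ht
  refine ⟨GenusTwo.TopologicalSolution.jetV_one_small hw,
    fun k hk α => GenusTwo.TopologicalSolution.jetV_small_of_two_le hw hk α,
    GenusTwo.termQ_smallEmb hG hw, fun G₂ => ?_⟩
  have h1 : S.jetU C 1 (GenusTwo.smallEmb w) = fun _ => 1 :=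
    funext (GenusTwo.TopologicalSolution.jetU_one_small C hw)
  have h2 : S.jetU C 2 (GenusTwo.smallEmb w) = fun _ => 0 :=
    funext (GenusTwo.TopologicalSolution.jetU_two_small C hw)
  simp only [GenusTwo.genusTwoDecomposition, GenusTwo.termQ_smallEmb hG hw, mul_zero,
    Finset.sum_const_zero, zero_add, h1, h2]
  -- The zeroth jet `S.jetU C 0` is `C.u (S.v t)` by definition.
  rfl
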